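/- Let $\mathcal H$ be a separable infinite-dimensional complex Hilbert space with a fixed orthonormal basis $(e_n)_{n\ge1}$; for a bounded sequence $(s_n)$ let $\operatorname{diag}\{s_n\}$ be the bounded operator with $e_n\mapsto s_ne_n$. Let $\mathcal J$ be a two-sided ideal of $B(\mathcal H)$ that consists of compact operators and is geometrically stable, i.e. for every real sequence $s_1\ge s_2\ge\cdots\ge0$ one has $\operatorname{diag}\{s_n\}\in\mathcal J$ if and only if $\operatorname{diag}\{(s_1s_2\cdots s_n)^{1/n}\}\in\mathcal J$. (This condition does not depend on the choice of the basis.) Then every $T\in\mathcal J$ can be written as $T=D+Q$, where $D\in\mathcal J$ is normal and $Q\in\mathcal J$ is quasi-nilpotent, i.e. the spectrum of $Q$ is $\{0\}$. -/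

import Mathlib

/-- `A` is the diagonal operator `diag {s₀, s₁, …}` with respect to the orthonormal basis `b`.
A bounded operator is determined by its values on an orthonormal basis, so there is at most one
such `A`, and there is one exactly when the sequence `s` is bounded. -/
def IsDiag {H : Type*} [NormedAddCommGroup H] [InnerProductSpace ℂ H]
    (b : HilbertBasis ℕ ℂ H) (s : ℕ → ℝ) (A : H →L[ℂ] H) : Prop :=
  ∀ n, A (b n) = (s n : ℂ) • b n

/-- The operator `diag {s₀, s₁, …}` (with respect to `b`) exists and belongs to the ideal `J`. -/
def DiagMem {H : Type*} [NormedAddCommGroup H] [InnerProductSpace ℂ H]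
    (J : TwoSidedIdeal (H →L[ℂ] H)) (b : HilbertBasis ℕ ℂ H) (s : ℕ → ℝ) : Prop :=
  ∃ A ∈ J, IsDiag b s A

/-- The sequence of geometric means `(s₁ ⋯ sₙ)^(1/n)`, `n ≥ 1`, with indices shifted to start
at `0`. -/
noncomputable def geomMeans (s : ℕ → ℝ) (n : ℕ) : ℝ :=
  (∏ i ∈ Finset.range (n + 1), s i) ^ ((1 : ℝ) / ((n : ℝ) + 1))

/-- Membership of `diag {sₙ}` in a two-sided ideal does not depend on the orthonormal basis. -/
theorem DiagMem.change_basis {H : Type*} [NormedAddCommGroup H] [InnerProductSpace ℂ H]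
    {J : TwoSidedIdeal (H →L[ℂ] H)} {b : HilbertBasis ℕ ℂ H} {s : ℕ → ℝ}
    (h : DiagMem J b s) (b' : HilbertBasis ℕ ℂ H) : DiagMem J b' s := by
  obtain ⟨A, hA, hd⟩ := h
  let U : H ≃ₗᵢ[ℂ] H := b.repr.trans b'.repr.symm
  have hU : ∀ n, U (b n) = b' n := fun n => by
    change b'.repr.symm (b.repr (b n)) = b' n
    rw [b.repr_self, b'.repr_symm_single]
  have hU' : ∀ n, U.symm (b' n) = b n := fun n => by rw [← hU n]; simp
  refine ⟨(U.toContinuousLinearEquiv : H →L[ℂ] H) * A *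
    (U.symm.toContinuousLinearEquiv : H →L[ℂ] H),
    J.mul_mem_right _ _ (J.mul_mem_left _ _ hA), fun n => ?_⟩
  simp [hU', hd n, hU]

/-- Geometric stability of an ideal `J` of operators on a separable infinite-dimensional Hilbert
space: for every decreasing sequence `s₁ ≥ s₂ ≥ ⋯ ≥ 0`, the operator `diag {sₙ}` is in `J` if
and only if `diag {(s₁ ⋯ sₙ)^(1/n)}` is. The orthonormal basis used to form `diag` is immaterial
(`DiagMem.change_basis`). -/
def IsGeometricallyStable {H : Type*} [NormedAddCommGroup H] [InnerProductSpace ℂ H]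
    (J : TwoSidedIdeal (H →L[ℂ] H)) : Prop :=
  ∃ b : HilbertBasis ℕ ℂ H, ∀ s : ℕ → ℝ, Antitone s → (∀ n, 0 ≤ s n) →
    (DiagMem J b s ↔ DiagMem J b (geomMeans s))

/-- A bounded operator is quasi-nilpotent if its spectrum is `{0}`. -/
def IsQuasinilpotent {H : Type*} [NormedAddCommGroup H] [InnerProductSpace ℂ H]
    (Q : H →L[ℂ] H) : Prop :=
  spectrum ℂ Q = {0}

/-! The idea is to split `T` into the diagonal and the strictly triangular part of a triangular
form. Starting from the zero subspace, repeatedly compress `T` to the complement of the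
finite-dimensional invariant subspace reached so far and adjoin an eigenvector whose eigenvalue has
maximal modulus. This gives orthogonal vectors `f n` and diagonal entries `l n` tending to `0`.

Let `D` be normal with `D (f n) = l n • f n` and zero on the complement of the `f n`. Weyl's
inequality (`prod_norm_le_prod_of_triangular`) bounds `‖l n‖` by the geometric mean of the first
singular values, so geometric stability puts `diag l`, hence `D`, in `J`.

`Q = T - D` is quasi-nilpotent (`isQuasinilpotent_of_triangular`): an eigenvector of `Q†` with
nonzero eigenvalue is orthogonal to every `f n`, hence an eigenvector of `T†`, and the maximal
choices bound its eigenvalue by every `‖l n‖`. -/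

open scoped InnerProductSpace InnerProduct

/-! ### Greedy triangularization of a compact operator. -/

section Triangularization

theorem mem_span_orthogonal_iff {H : Type*} [NormedAddCommGroup H]
    [InnerProductSpace ℂ H] {s : Set H} {g : H} :
    g ∈ (Submodule.span ℂ s)ᗮ ↔ ∀ x ∈ s, ⟪x, g⟫_ℂ = 0 := by
  rw [Submodule.mem_orthogonal]
  refine ⟨fun h x hx => h x (Submodule.subset_span hx), fun h u hu => ?_⟩
  induction hu using Submodule.span_induction with
  | mem x hx => exact h x hx
  | zero => simp
  | add x y _ _ hx hy => simp [inner_add_left, hx, hy]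
  | smul a x _ hx => simp [inner_smul_left, hx]

variable {H : Type*} [NormedAddCommGroup H] [InnerProductSpace ℂ H] [CompleteSpace H]

theorem norm_adjoint_apply_sq_le (T : H →L[ℂ] H) (x : H) :
    ‖(T†) x‖ ^ 2 ≤ ‖T ((T†) x)‖ * ‖x‖ := by
  rw [← inner_self_eq_norm_sq (𝕜 := ℂ), ContinuousLinearMap.adjoint_inner_right]
  exact (RCLike.re_le_norm _).trans (norm_inner_le_norm _ _)

/-- Schauder's theorem on a Hilbert space. -/
theorem IsCompactOperator.adjoint {T : H →L[ℂ] H} (hT : IsCompactOperator T) :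
    IsCompactOperator (T†) := by
  refine (isCompactOperator_iff_isCompact_closure_image_ball ((T†) : H →ₗ[ℂ] H) one_pos).2 ?_
  refine TotallyBounded.isCompact_of_isClosed (TotallyBounded.closure ?_) isClosed_closure
  rw [Metric.totallyBounded_iff]
  intro ε hε
  obtain ⟨K, hK, hKs⟩ := (hT.comp_clm (T†)).image_ball_subset_compact
    (f := ((T ∘L (T†) : H →L[ℂ] H) : H →ₗ[ℂ] H)) 1
  -- Two points of the unit ball are at most `2` apart, so `norm_adjoint_apply_sq_le` turns an `ε ^
  -- 2 / 2`-net for `T T†` into an `ε`-net for `T†`.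
  obtain ⟨t, hts, htf, hcov⟩ := Set.exists_subset_image_finite_and.1
    (Metric.finite_approx_of_totallyBounded (hK.totallyBounded.subset hKs) (ε ^ 2 / 2)
      (by positivity))
  refine ⟨(T†) '' t, htf.image _, ?_⟩
  rintro _ ⟨x, hx, rfl⟩
  have hmem := hcov ⟨x, hx, rfl⟩
  simp only [Set.biUnion_image, Set.mem_iUnion, Metric.mem_ball, exists_prop] at hmem ⊢
  obtain ⟨y, hy, hxy⟩ := hmem
  refine ⟨y, hy, ?_⟩
  have hy1 := hts hy
  rw [mem_ball_zero_iff] at hx hy1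
  simp only [ContinuousLinearMap.coe_coe, ContinuousLinearMap.comp_apply, dist_eq_norm,
    ← map_sub] at hxy ⊢
  have h1 := norm_adjoint_apply_sq_le T (x - y)
  have h2 : ‖x - y‖ ≤ 2 := (norm_sub_le x y).trans (by linarith)
  have h3 : ‖T ((T†) (x - y))‖ * ‖x - y‖ ≤ ‖T ((T†) (x - y))‖ * 2 := by gcongr
  exact lt_of_pow_lt_pow_left₀ 2 hε.le (by linarith)

theorem IsCompactOperator.exists_eigenvector {T : H →L[ℂ] H} (hT : IsCompactOperator T) {μ : ℂ}
    (hμ : μ ≠ 0) (h : μ ∈ spectrum ℂ T) : ∃ g, g ≠ 0 ∧ T g = μ • g := by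
  obtain ⟨g, hg⟩ := ((hT.hasEigenvalue_iff_mem_spectrum hμ).2 h).exists_hasEigenvector
  exact ⟨g, hg.2, hg.apply_eq_smul⟩

theorem mem_spectrum_of_eigenvector {T : H →L[ℂ] H} {μ : ℂ} {g : H} (hg : g ≠ 0)
    (h : T g = μ • g) : μ ∈ spectrum ℂ T := by
  rw [ContinuousLinearMap.spectrum_eq]
  exact (Module.End.hasEigenvalue_of_hasEigenvector
    (Module.End.hasEigenvector_iff.2 ⟨Module.End.mem_eigenspace_iff.2 h, hg⟩)).mem_spectrum

theorem star_mem_spectrum_adjoint {T : H →L[ℂ] H} {μ : ℂ} :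
    star μ ∈ spectrum ℂ (T†) ↔ μ ∈ spectrum ℂ T := by
  rw [← ContinuousLinearMap.star_eq_adjoint, spectrum.map_star, Set.mem_star, star_star]

theorem exists_norm_max_spectrum [Nontrivial H] (T : H →L[ℂ] H) :
    ∃ z ∈ spectrum ℂ T, ∀ w ∈ spectrum ℂ T, ‖w‖ ≤ ‖z‖ := by
  obtain ⟨z, hz, hr⟩ := spectrum.exists_nnnorm_eq_spectralRadius T
  refine ⟨z, hz, fun w hw => ?_⟩
  have : (‖w‖₊ : ENNReal) ≤ ‖z‖₊ := by
    rw [hr]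
    exact le_iSup₂ (f := fun k (_ : k ∈ spectrum ℂ T) => (‖k‖₊ : ENNReal)) w hw
  exact_mod_cast this

/-- One step of the triangularization: an eigenvector, for an eigenvalue of maximal modulus, of
the compression of `T` to the orthogonal complement of an invariant subspace. -/
theorem IsCompactOperator.exists_next_vector [Nontrivial H] {T : H →L[ℂ] H}
    (hT : IsCompactOperator T) (V : Submodule ℂ H) [FiniteDimensional ℂ V]
    (hV : ∀ x ∈ V, T x ∈ V) :
    ∃ p : H × ℂ, p.1 ∈ Vᗮ ∧ (p.2 ≠ 0 → ‖p.1‖ = 1) ∧ (p.2 = 0 → p.1 = 0) ∧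
      T p.1 - p.2 • p.1 ∈ V ∧
      (∀ μ : ℂ, ∀ g ∈ Vᗮ, g ≠ 0 → (T†) g = μ • g → ‖μ‖ ≤ ‖p.2‖) ∧
      (IsSelfAdjoint T → ∀ g ∈ Vᗮ, ‖⟪T g, g⟫_ℂ‖ ≤ ‖p.2‖ * ‖g‖ ^ 2) ∧
      (p.2 ≠ 0 → ∃ g ∈ Vᗮ, g ≠ 0 ∧ (T†) g = star p.2 • g) := by
  set P : H →L[ℂ] H := Vᗮ.starProjection with hP
  have hPs : P† = P := (isSelfAdjoint_starProjection Vᗮ).adjoint_eq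
  have hPg : ∀ g ∈ Vᗮ, P g = g := fun g hg => Submodule.starProjection_eq_self_iff.2 hg
  have hPm : ∀ x, P x ∈ Vᗮ := fun x => Submodule.starProjection_apply_mem _ x
  have hPV : ∀ x, x - P x ∈ V := fun x => by
    have := Vᗮ.sub_starProjection_mem_orthogonal x
    rwa [Submodule.orthogonal_orthogonal] at this
  set C : H →L[ℂ] H := P ∘L T ∘L P with hC
  have hCs : C† = P ∘L (T†) ∘L P := by
    simp only [hC, ContinuousLinearMap.adjoint_comp, hPs, ContinuousLinearMap.comp_assoc]
  have hCc : IsCompactOperator C := (hT.comp_clm P).clm_comp P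
  have hTV : ∀ g ∈ Vᗮ, (T†) g ∈ Vᗮ := fun g hg => (Submodule.mem_orthogonal _ _).2 fun u hu => by
    rw [ContinuousLinearMap.adjoint_inner_right]
    exact Submodule.inner_right_of_mem_orthogonal (hV u hu) hg
  obtain ⟨z, hz, hmax⟩ := exists_norm_max_spectrum C
  have hle : ∀ μ : ℂ, ∀ g ∈ Vᗮ, g ≠ 0 → (T†) g = μ • g → ‖μ‖ ≤ ‖z‖ := fun μ g hg hg0 h => by
    have : star (star μ) ∈ spectrum ℂ (C†) := by
      refine mem_spectrum_of_eigenvector hg0 ?_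
      simp [hCs, hPg g hg, h]
    simpa using hmax _ (star_mem_spectrum_adjoint.1 this)
  have hsa : IsSelfAdjoint T → ∀ g ∈ Vᗮ, ‖⟪T g, g⟫_ℂ‖ ≤ ‖z‖ * ‖g‖ ^ 2 := fun h g hg => by
    have hCsa : IsSelfAdjoint C := by
      rw [ContinuousLinearMap.isSelfAdjoint_iff', hCs, h.adjoint_eq]
    -- For self-adjoint `C` the norm is the spectral radius, which `z` attains.
    have hn : ‖C‖ ≤ ‖z‖ := by
      have : (‖C‖₊ : ENNReal) ≤ ‖z‖₊ := by
        rw [← C.spectralRadius_eq_nnnorm hCsa]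
        exact iSup₂_le fun w hw => by exact_mod_cast hmax w hw
      exact_mod_cast this
    have h1 : ⟪T g, g⟫_ℂ = ⟪C g, g⟫_ℂ := by
      calc ⟪T g, g⟫_ℂ = ⟪T g, (P†) g⟫_ℂ := by rw [hPs, hPg g hg]
        _ = ⟪P (T g), g⟫_ℂ := ContinuousLinearMap.adjoint_inner_right _ _ _
        _ = ⟪C g, g⟫_ℂ := by simp [hC, hPg g hg]
    rw [h1]
    calc ‖⟪C g, g⟫_ℂ‖ ≤ ‖C g‖ * ‖g‖ := norm_inner_le_norm _ _
      _ ≤ (‖C‖ * ‖g‖) * ‖g‖ := by gcongr; exact C.le_opNorm g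
      _ ≤ (‖z‖ * ‖g‖) * ‖g‖ := by gcongr
      _ = _ := by ring
  -- A quasi-nilpotent compression ends the process; the sequence is then padded with zeros.
  by_cases hz0 : z = 0
  · exact ⟨(0, z), by simp, fun h => (h hz0).elim, fun _ => rfl, by simp, hle, hsa,
      fun h => (h hz0).elim⟩
  obtain ⟨f, hf0, hf⟩ := hCc.exists_eigenvector hz0 hz
  have hfV : f ∈ Vᗮ := by
    have : f = z⁻¹ • C f := by rw [hf, smul_smul, inv_mul_cancel₀ hz0, one_smul]
    rw [this]
    exact Submodule.smul_mem _ _ (hPm _)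
  have hTf : T f - z • f ∈ V := by
    rw [← hf]
    simpa [hC, hPg f hfV] using hPV (T f)
  refine ⟨(((‖f‖⁻¹ : ℝ) : ℂ) • f, z), Submodule.smul_mem _ _ hfV, fun _ => ?_,
    fun h => (hz0 h).elim, ?_, hle, hsa, fun _ => ?_⟩
  · simp [norm_smul, hf0]
  · have := V.smul_mem (((‖f‖⁻¹ : ℝ) : ℂ)) hTf
    rwa [smul_sub, smul_comm _ z f, ← map_smul] at this
  · have hCac : IsCompactOperator (C†) := hCc.adjoint
    obtain ⟨g, hg0, hg⟩ := hCac.exists_eigenvector (star_ne_zero.2 hz0)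
      (star_mem_spectrum_adjoint.2 hz)
    have hgV : g ∈ Vᗮ := by
      have : g = (star z)⁻¹ • (C†) g := by
        rw [hg, smul_smul, inv_mul_cancel₀ (star_ne_zero.2 hz0), one_smul]
      rw [this, hCs]
      exact Submodule.smul_mem _ _ (hPm _)
    refine ⟨g, hgV, hg0, ?_⟩
    rw [← hg, hCs]
    simp [hPg g hgV, hPg _ (hTV g hgV)]

/-- `f` is an orthogonal sequence of unit vectors (or zero vectors, where `l` vanishes) in which
`T` is triangular with diagonal `l`, obtained by splitting off at each step an eigenvalue of
maximal modulus. -/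
structure IsGreedyTriangularization (T : H →L[ℂ] H) (f : ℕ → H) (l : ℕ → ℂ) : Prop where
  inner_eq_zero : ∀ {i j}, i ≠ j → ⟪f i, f j⟫_ℂ = 0
  norm_eq_one : ∀ {n}, l n ≠ 0 → ‖f n‖ = 1
  eq_zero : ∀ {n}, l n = 0 → f n = 0
  sub_mem : ∀ n, T (f n) - l n • f n ∈ Submodule.span ℂ (f '' Set.Iio n)
  norm_le : ∀ n (μ : ℂ) g, g ≠ 0 → (∀ i < n, ⟪f i, g⟫_ℂ = 0) → (T†) g = μ • g → ‖μ‖ ≤ ‖l n‖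
  norm_inner_le : IsSelfAdjoint T → ∀ n g, (∀ i < n, ⟪f i, g⟫_ℂ = 0) →
    ‖⟪T g, g⟫_ℂ‖ ≤ ‖l n‖ * ‖g‖ ^ 2
  antitone : Antitone fun n => ‖l n‖

theorem IsCompactOperator.exists_greedyTriangularization [Nontrivial H] {T : H →L[ℂ] H}
    (hT : IsCompactOperator T) : ∃ f l, IsGreedyTriangularization T f l := by
  let X := {V : Submodule ℂ H // FiniteDimensional ℂ V ∧ ∀ x ∈ V, T x ∈ V}
  have key : ∀ V : X, _ := fun V =>
    have := V.2.1
    hT.exists_next_vector V.1 V.2.2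
  choose F hF using key
  have step : ∀ V : X, FiniteDimensional ℂ ↥(V.1 ⊔ Submodule.span ℂ {(F V).1}) ∧
      ∀ x ∈ V.1 ⊔ Submodule.span ℂ {(F V).1}, T x ∈ V.1 ⊔ Submodule.span ℂ {(F V).1} := by
    intro V
    have := V.2.1
    refine ⟨inferInstance, fun x hx => ?_⟩
    obtain ⟨v, hv, w, hw, rfl⟩ := Submodule.mem_sup.1 hx
    obtain ⟨a, rfl⟩ := Submodule.mem_span_singleton.1 hw
    rw [map_add, map_smul]
    refine add_mem (Submodule.mem_sup_left (V.2.2 v hv)) (Submodule.smul_mem _ _ ?_)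
    have h1 := (hF V).2.2.2.1
    rw [← sub_add_cancel (T (F V).1) ((F V).2 • (F V).1)]
    exact add_mem (Submodule.mem_sup_left h1) (Submodule.mem_sup_right
      (Submodule.smul_mem _ _ (Submodule.mem_span_singleton_self _)))
  let V : ℕ → X := Nat.rec ⟨⊥, inferInstance, by simp⟩
    fun _ V => ⟨V.1 ⊔ Submodule.span ℂ {(F V).1}, step V⟩
  let f : ℕ → H := fun n => (F (V n)).1
  let l : ℕ → ℂ := fun n => (F (V n)).2
  have hVs : ∀ n, (V n).1 = Submodule.span ℂ (f '' Set.Iio n) := by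
    intro n
    induction n with
    | zero => simp [V]
    | succ n ih =>
      have : (V (n + 1)).1 = (V n).1 ⊔ Submodule.span ℂ {f n} := rfl
      rw [this, ih, ← Submodule.span_union]
      congr 1
      ext x
      simp only [Set.mem_union, Set.mem_image, Set.mem_Iio, Set.mem_singleton_iff]
      constructor
      · rintro (⟨i, hi, rfl⟩ | rfl)
        · exact ⟨i, by lia, rfl⟩
        · exact ⟨n, by lia, rfl⟩
      · rintro ⟨i, hi, rfl⟩
        rcases Nat.lt_succ_iff_lt_or_eq.1 hi with h | rfl
        · exact Or.inl ⟨i, h, rfl⟩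
        · exact Or.inr rfl
  have hperp : ∀ n g, g ∈ (V n).1ᗮ ↔ ∀ i < n, ⟪f i, g⟫_ℂ = 0 := fun n g => by
    rw [hVs, mem_span_orthogonal_iff]
    simp
  have hlt : ∀ i j, i < j → ⟪f i, f j⟫_ℂ = 0 := fun i j hij =>
    (hperp j (f j)).1 (hF (V j)).1 i hij
  have hnorm : ∀ n (μ : ℂ) g, g ≠ 0 → (∀ i < n, ⟪f i, g⟫_ℂ = 0) → (T†) g = μ • g →
      ‖μ‖ ≤ ‖l n‖ := fun n μ g hg h => (hF (V n)).2.2.2.2.1 μ g ((hperp n g).2 h) hg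
  refine ⟨f, l, ⟨fun {i j} hij => ?_, fun {n} => (hF (V n)).2.1, fun {n} => (hF (V n)).2.2.1,
    fun n => hVs n ▸ (hF (V n)).2.2.2.1, hnorm,
    fun h n g hg => (hF (V n)).2.2.2.2.2.1 h g ((hperp n g).2 hg), ?_⟩⟩
  · rcases lt_or_gt_of_ne hij with h | h
    · exact hlt i j h
    · exact inner_eq_zero_symm.1 (hlt j i h)
  · refine antitone_nat_of_succ_le fun n => ?_
    by_cases h0 : l (n + 1) = 0
    · simp [h0]
    -- This eigenvector of `T†` also lies in the larger complement of step `n`, so it competed in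
    -- the maximum there.
    obtain ⟨g, hg, hg0, h⟩ := (hF (V (n + 1))).2.2.2.2.2.2 h0
    have := hnorm n _ g hg0 (fun i hi => (hperp (n + 1) g).1 hg i (by lia)) h
    simpa using this

namespace IsGreedyTriangularization

variable {T : H →L[ℂ] H} {f : ℕ → H} {l : ℕ → ℂ}

theorem inner_span_eq_zero (h : IsGreedyTriangularization T f l) {n : ℕ} {x : H}
    (hx : x ∈ Submodule.span ℂ (f '' Set.Iio n)) : ⟪x, f n⟫_ℂ = 0 := by
  refine Submodule.inner_right_of_mem_orthogonal hx (mem_span_orthogonal_iff.2 ?_)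
  rintro _ ⟨i, hi, rfl⟩
  exact h.inner_eq_zero (ne_of_lt hi)

theorem apply_mem (h : IsGreedyTriangularization T f l) {m n : ℕ} (hmn : m < n) :
    T (f m) ∈ Submodule.span ℂ (f '' Set.Iio n) := by
  rw [← sub_add_cancel (T (f m)) (l m • f m)]
  refine add_mem (Submodule.span_mono (Set.image_mono (Set.Iio_subset_Iio hmn.le)) (h.sub_mem m))
    (Submodule.smul_mem _ _ (Submodule.subset_span ⟨m, hmn, rfl⟩))

theorem inner_apply_self (h : IsGreedyTriangularization T f l) (n : ℕ) :
    ⟪f n, T (f n)⟫_ℂ = l n := by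
  have h1 := inner_eq_zero_symm.1 (h.inner_span_eq_zero (h.sub_mem n))
  rw [inner_sub_right, sub_eq_zero, inner_smul_right] at h1
  rw [h1]
  by_cases h0 : l n = 0
  · simp [h0]
  · simp [inner_self_eq_norm_sq_to_K, h.norm_eq_one h0]

theorem norm_vector_le (h : IsGreedyTriangularization T f l) (n : ℕ) : ‖f n‖ ≤ 1 := by
  by_cases h0 : l n = 0
  · simp [h.eq_zero h0]
  · exact (h.norm_eq_one h0).le

/-- For `m < n` the vector `T (f m)` is orthogonal to `f n`, while `T (f n)` has component `l n`
along it. If `‖l n‖ ≥ ε` always held, the `T (f n)` would be `ε`-separated, against compactness. -/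
theorem tendsto_zero (h : IsGreedyTriangularization T f l) (hT : IsCompactOperator T) :
    Filter.Tendsto l Filter.atTop (nhds 0) := by
  rw [tendsto_zero_iff_norm_tendsto_zero, Metric.tendsto_atTop]
  intro ε hε
  by_contra! hcon
  have hbig : ∀ n, ε ≤ ‖l n‖ := fun n => by
    obtain ⟨m, hm, hm'⟩ := hcon n
    rw [dist_zero_right, norm_norm] at hm'
    exact hm'.trans (h.antitone hm)
  have hsep : ∀ m n, m < n → ε ≤ dist (T (f n)) (T (f m)) := fun m n hmn => by
    have h1 : ⟪f n, T (f n) - T (f m)⟫_ℂ = l n := by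
      rw [inner_sub_right, h.inner_apply_self,
        inner_eq_zero_symm.1 (h.inner_span_eq_zero (h.apply_mem hmn)), sub_zero]
    calc ε ≤ ‖l n‖ := hbig n
      _ ≤ ‖f n‖ * ‖T (f n) - T (f m)‖ := h1 ▸ norm_inner_le_norm _ _
      _ ≤ 1 * ‖T (f n) - T (f m)‖ := by gcongr; exact h.norm_vector_le n
      _ = _ := by rw [one_mul, dist_eq_norm]
  obtain ⟨K, hK, hKs⟩ := hT.image_closedBall_subset_compact (f := (T : H →ₗ[ℂ] H)) 1
  obtain ⟨y, -, φ, hφ, hy⟩ := hK.tendsto_subseq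
    (fun n => hKs ⟨f n, by simpa using h.norm_vector_le n, rfl⟩)
  obtain ⟨N, hN⟩ := Metric.cauchySeq_iff'.1 hy.cauchySeq ε hε
  exact (hN (N + 1) (by lia)).not_ge (hsep _ _ (hφ (by lia)))

end IsGreedyTriangularization

end Triangularization

/-! ### Diagonal operators and partial isometries built from a Hilbert basis. -/

section DiagonalOperators

variable {H : Type*} [NormedAddCommGroup H] [InnerProductSpace ℂ H]

theorem HilbertBasis.ext_clm {b : HilbertBasis ℕ ℂ H} {A B : H →L[ℂ] H}
    (h : ∀ n, A (b n) = B (b n)) : A = B :=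
  ContinuousLinearMap.ext_on (Submodule.dense_iff_topologicalClosure_eq_top.2 b.dense_span)
    (by rintro _ ⟨n, rfl⟩; exact h n)

theorem HilbertBasis.ext_inner {b : HilbertBasis ℕ ℂ H} {x y : H}
    (h : ∀ n, ⟪b n, x⟫_ℂ = ⟪b n, y⟫_ℂ) : x = y := by
  refine b.repr.injective (lp.ext (funext fun n => ?_))
  rw [b.repr_apply_apply, b.repr_apply_apply, h n]

theorem sum_norm_inner_sq_le_of_orthogonal {v : ℕ → H}
    (ho : ∀ {i j}, i ≠ j → ⟪v i, v j⟫_ℂ = 0) (hn : ∀ i, v i = 0 ∨ ‖v i‖ = 1) (s : Finset ℕ)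
    (x : H) : ∑ i ∈ s, ‖⟪v i, x⟫_ℂ‖ ^ 2 ≤ ‖x‖ ^ 2 := by
  classical
  have hon : Orthonormal ℂ fun i : {i // v i ≠ 0} => v i :=
    ⟨fun i => (hn i).resolve_left i.2, fun i j hij => ho (fun h => hij (Subtype.ext h))⟩
  refine le_trans (le_of_eq ?_) (hon.sum_inner_products_le x (s := s.subtype fun i => v i ≠ 0))
  rw [Finset.sum_subtype_eq_sum_filter (p := fun i => v i ≠ 0) (fun i => ‖⟪v i, x⟫_ℂ‖ ^ 2)]
  refine (Finset.sum_filter_of_ne (p := fun i => v i ≠ 0) fun i _ hi h0 => hi ?_).symm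
  simp [h0]

variable [CompleteSpace H]

/-- A sequence satisfying a Bessel inequality is the image of an orthonormal basis under a bounded
operator. -/
theorem HilbertBasis.exists_clm_of_bessel (b : HilbertBasis ℕ ℂ H) (v : ℕ → H) (C : ℝ)
    (hv : ∀ (s : Finset ℕ) x, ∑ i ∈ s, ‖⟪v i, x⟫_ℂ‖ ^ 2 ≤ C ^ 2 * ‖x‖ ^ 2) :
    ∃ V : H →L[ℂ] H, ∀ n, V (b n) = v n := by
  have hmem : ∀ x, Memℓp (fun i => ⟪v i, x⟫_ℂ) 2 := fun x =>
    memℓp_gen' (C := C ^ 2 * ‖x‖ ^ 2) fun s => by simpa using hv s x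
  let W : H →ₗ[ℂ] lp (fun _ : ℕ => ℂ) 2 :=
    { toFun := fun x => ⟨_, hmem x⟩
      map_add' := fun x y => lp.ext (funext fun i => inner_add_right _ _ _)
      map_smul' := fun a x => lp.ext (funext fun i => inner_smul_right _ _ _) }
  have hW : ∀ x, ‖W x‖ ≤ |C| * ‖x‖ := fun x => by
    refine lp.norm_le_of_forall_sum_le (by norm_num) (by positivity) fun s => ?_
    simpa [mul_pow, W] using hv s x
  let A : H →L[ℂ] H :=
    (b.repr.symm.toContinuousLinearEquiv : lp (fun _ : ℕ => ℂ) 2 →L[ℂ] H) ∘L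
      W.mkContinuous |C| hW
  have hA : ∀ n x, ⟪b n, A x⟫_ℂ = ⟪v n, x⟫_ℂ := fun n x => by
    rw [← b.repr_apply_apply]
    simp [A, W]
  refine ⟨A†, fun n => ext_inner_right ℂ fun x => ?_⟩
  rw [ContinuousLinearMap.adjoint_inner_left, hA]

/-- Such a `V` is a partial isometry; zero vectors are allowed because triangularizations may be
padded with them. -/
theorem HilbertBasis.exists_clm_of_orthogonal (b : HilbertBasis ℕ ℂ H) {v : ℕ → H}
    (ho : ∀ {i j}, i ≠ j → ⟪v i, v j⟫_ℂ = 0) (hn : ∀ i, v i = 0 ∨ ‖v i‖ = 1) :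
    ∃ V : H →L[ℂ] H, (∀ n, V (b n) = v n) ∧ (∀ n, v n ≠ 0 → (V†) (v n) = b n) ∧
      ∀ g, (∀ n, ⟪v n, g⟫_ℂ = 0) → (V†) g = 0 := by
  obtain ⟨V, hV⟩ := b.exists_clm_of_bessel v 1
    fun s x => by simpa using sum_norm_inner_sq_le_of_orthogonal ho hn s x
  have hVi : ∀ n g, ⟪b n, (V†) g⟫_ℂ = ⟪v n, g⟫_ℂ := fun n g => by
    rw [ContinuousLinearMap.adjoint_inner_right, hV]
  refine ⟨V, hV, fun n h => b.ext_inner fun m => ?_, fun g hg => b.ext_inner fun m => ?_⟩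
  · rw [hVi]
    by_cases hmn : m = n
    · subst hmn
      rw [inner_self_eq_norm_sq_to_K, inner_self_eq_norm_sq_to_K, (hn m).resolve_left h,
        b.orthonormal.1 m]
    · rw [ho hmn, b.orthonormal.2 hmn]
  · rw [hVi, hg, inner_zero_right]

theorem HilbertBasis.exists_diagonal (b : HilbertBasis ℕ ℂ H) (m : ℕ → ℂ) (C : ℝ)
    (hm : ∀ n, ‖m n‖ ≤ C) : ∃ M : H →L[ℂ] H, ∀ n, M (b n) = m n • b n := by
  refine b.exists_clm_of_bessel _ C fun s x => ?_
  refine le_trans ?_ (mul_le_mul_of_nonneg_left (b.orthonormal.sum_inner_products_le x (s := s))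
    (sq_nonneg C))
  rw [Finset.mul_sum]
  refine Finset.sum_le_sum fun i _ => ?_
  rw [inner_smul_left, norm_mul, mul_pow, RCLike.norm_conj]
  gcongr
  exact hm i

theorem HilbertBasis.adjoint_diagonal {b : HilbertBasis ℕ ℂ H} {m : ℕ → ℂ} {M : H →L[ℂ] H}
    (h : ∀ n, M (b n) = m n • b n) (n : ℕ) : (M†) (b n) = star (m n) • b n := by
  refine b.ext_inner fun k => ?_
  rw [ContinuousLinearMap.adjoint_inner_right, h, inner_smul_left, inner_smul_right]
  by_cases hkn : k = n
  · rw [hkn]; rfl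
  · rw [b.orthonormal.2 hkn, mul_zero, mul_zero]

/-- If `diag s ∈ J` and `|lₙ| ≤ sₙ` then `diag l ∈ J`. -/
theorem DiagMem.exists_of_norm_le {J : TwoSidedIdeal (H →L[ℂ] H)} {b : HilbertBasis ℕ ℂ H}
    {s : ℕ → ℝ} (h : DiagMem J b s) {l : ℕ → ℂ} (hl : ∀ n, ‖l n‖ ≤ s n) :
    ∃ A ∈ J, ∀ n, A (b n) = l n • b n := by
  obtain ⟨G, hG, hGs⟩ := h
  obtain ⟨M, hM⟩ := b.exists_diagonal (fun n => l n / s n) 1 fun n => by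
    rw [norm_div, Complex.norm_real]
    exact div_le_one_of_le₀ ((hl n).trans (le_abs_self _)) (norm_nonneg _)
  refine ⟨M * G, J.mul_mem_left _ _ hG, fun n => ?_⟩
  rw [mul_apply_eq_comp, hGs n, map_smul, hM, smul_smul]
  by_cases h0 : s n = 0
  · have : l n = 0 := norm_le_zero_iff.1 (h0 ▸ hl n)
    simp [this]
  · rw [mul_div_cancel₀ _ (Complex.ofReal_ne_zero.2 h0)]

end DiagonalOperators

/-! ### Singular values and Weyl's inequality. -/

section Weyl

variable {H : Type*} [NormedAddCommGroup H] [InnerProductSpace ℂ H]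

/-- Singular values of a compact operator, with the right singular vectors `u`. -/
theorem IsCompactOperator.exists_singularValues [CompleteSpace H] [Nontrivial H]
    {T : H →L[ℂ] H}
    (hT : IsCompactOperator T) : ∃ (u : ℕ → H) (s : ℕ → ℝ), Antitone s ∧ (∀ n, 0 ≤ s n) ∧
      (∀ {i j}, i ≠ j → ⟪u i, u j⟫_ℂ = 0) ∧ (∀ n, u n = 0 ∨ ‖u n‖ = 1) ∧
      (∀ {i j}, i ≠ j → ⟪T (u i), T (u j)⟫_ℂ = 0) ∧ (∀ n, ‖T (u n)‖ = s n) ∧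
      ∀ n g, (∀ i < n, ⟪u i, g⟫_ℂ = 0) → ‖T g‖ ≤ s n * ‖g‖ := by
  have hA : IsCompactOperator ((T†) ∘L T) := hT.clm_comp (T†)
  have hAsa : IsSelfAdjoint ((T†) ∘L T) := by
    rw [ContinuousLinearMap.isSelfAdjoint_iff']
    simp [ContinuousLinearMap.adjoint_comp]
  have hTT : ∀ x y, ⟪x, ((T†) ∘L T) y⟫_ℂ = ⟪T x, T y⟫_ℂ := fun x y => by
    rw [ContinuousLinearMap.comp_apply, ContinuousLinearMap.adjoint_inner_right]
  -- For the self-adjoint operator `T† T` the triangularization is a diagonalization, with `l n` the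
  -- squared singular values.
  obtain ⟨u, l, h⟩ := hA.exists_greedyTriangularization
  have hl : ∀ n, ‖T (u n)‖ ^ 2 = ‖l n‖ := fun n => by
    rw [← h.inner_apply_self n, hTT, inner_self_eq_norm_sq_to_K]
    simp
  have hlt : ∀ i j, i < j → ⟪T (u i), T (u j)⟫_ℂ = 0 := fun i j hij => by
    have := h.inner_span_eq_zero (h.apply_mem hij)
    rwa [← hTT, ← ContinuousLinearMap.adjoint_inner_left, hAsa.adjoint_eq]
  have hle : ∀ n g, (∀ i < n, ⟪u i, g⟫_ℂ = 0) → ‖T g‖ ≤ ‖T (u n)‖ * ‖g‖ := fun n g hg => by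
    have h1 := h.norm_inner_le hAsa n g hg
    rw [norm_inner_symm, hTT, inner_self_eq_norm_sq_to_K, ← hl, ← mul_pow] at h1
    refine le_of_sq_le_sq ?_ (by positivity)
    simpa using h1
  refine ⟨u, fun n => ‖T (u n)‖, fun m n hmn => ?_, fun n => norm_nonneg _, h.inner_eq_zero,
    fun n => ?_, fun {i j} hij => ?_, fun n => rfl, hle⟩
  · refine le_of_sq_le_sq ?_ (norm_nonneg _)
    rw [hl, hl]
    exact h.antitone hmn
  · by_cases h0 : l n = 0
    · exact Or.inl (h.eq_zero h0)
    · exact Or.inr (h.norm_eq_one h0)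
  · rcases lt_or_gt_of_ne hij with h' | h'
    · exact hlt i j h'
    · exact inner_eq_zero_symm.1 (hlt j i h')

/-- Hadamard's inequality for the determinant of an operator in an orthonormal basis. -/
theorem LinearMap.norm_det_le_prod_norm {E : Type*} [NormedAddCommGroup E]
    [InnerProductSpace ℂ E] [FiniteDimensional ℂ E] {n : ℕ} (g : OrthonormalBasis (Fin n) ℂ E)
    (A : E →ₗ[ℂ] E) : ‖LinearMap.det A‖ ≤ ∏ i, ‖A (g i)‖ := by
  have hcard : Module.finrank ℂ E = Fintype.card (Fin n) :=
    Module.finrank_eq_card_basis g.toBasis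
  -- Relative to `e` the family `A ∘ g` is triangular with diagonal entries `⟪e i, A (g i)⟫`;
  -- passing between orthonormal bases changes the determinant only by a unimodular factor.
  set e := InnerProductSpace.gramSchmidtOrthonormalBasis hcard (A ∘ g) with he
  have h1 := InnerProductSpace.gramSchmidtOrthonormalBasis_det hcard (A ∘ g)
  rw [← he, Module.Basis.det_comp] at h1
  have h2 := congrArg norm h1
  rw [norm_mul, e.det_to_matrix_orthonormalBasis, mul_one, norm_prod] at h2
  rw [h2]
  refine Finset.prod_le_prod (fun i _ => norm_nonneg _) fun i _ => ?_
  have h3 := norm_inner_le_norm (𝕜 := ℂ) (e i) (A (g i))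
  rwa [e.norm_eq_one, one_mul] at h3

/-- Weyl's inequality: products of eigenvalues are dominated by products of singular values. -/
theorem prod_norm_le_prod_of_triangular {T : H →L[ℂ] H} {u f : ℕ → H} {s : ℕ → ℝ} {l : ℕ → ℂ}
    {n : ℕ} (hs : ∀ k g, (∀ i < k, ⟪u i, g⟫_ℂ = 0) → ‖T g‖ ≤ s k * ‖g‖)
    (hf : Orthonormal ℂ fun i : Fin n => f i)
    (hT : ∀ k < n, T (f k) - l k • f k ∈ Submodule.span ℂ (f '' Set.Iio k)) :
    ∏ i ∈ Finset.range n, ‖l i‖ ≤ ∏ i ∈ Finset.range n, s i := by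
  set E : Submodule ℂ H := Submodule.span ℂ (Set.range fun i : Fin n => f i) with hE
  have : FiniteDimensional ℂ E := FiniteDimensional.span_of_finite ℂ (Set.finite_range _)
  let B : Module.Basis (Fin n) ℂ E := Module.Basis.span hf.linearIndependent
  have hB : ∀ i, (B i : H) = f i := Module.Basis.coe_span_apply hf.linearIndependent
  have hfE : ∀ k < n, f k ∈ E := fun k hk => Submodule.subset_span ⟨⟨k, hk⟩, rfl⟩
  have hsub : ∀ k < n, Submodule.span ℂ (f '' Set.Iio k) ≤ E := fun k hk =>
    Submodule.span_le.2 (by rintro _ ⟨i, hi, rfl⟩; exact hfE i (lt_trans hi hk))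
  have hTE : ∀ x ∈ E, T x ∈ E := fun x hx => by
    induction hx using Submodule.span_induction with
    | mem x hx =>
      obtain ⟨i, rfl⟩ := hx
      rw [← sub_add_cancel (T (f i)) (l i • f i)]
      exact add_mem (hsub i i.2 (hT i i.2)) (Submodule.smul_mem _ _ (hfE i i.2))
    | zero => simp
    | add x y _ _ hx hy => rw [map_add]; exact add_mem hx hy
    | smul a x _ hx => rw [map_smul]; exact Submodule.smul_mem _ _ hx
  let A : E →ₗ[ℂ] E := (T : H →ₗ[ℂ] H).restrict hTE
  have hA : ∀ x : E, (A x : H) = T x := fun x => rfl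
  have hrepr : ∀ (x : E) i, B.repr x i = ⟪f i, (x : H)⟫_ℂ := fun x i => by
    conv_rhs => rw [← B.sum_repr x]
    simp only [Submodule.coe_sum, Submodule.coe_smul, hB]
    rw [hf.inner_right_fintype]
  have hort : ∀ i j : Fin n, ∀ x ∈ Submodule.span ℂ (f '' Set.Iio (j : ℕ)), j ≤ i →
      ⟪f i, x⟫_ℂ = 0 := fun i j x hx hji => by
    refine inner_eq_zero_symm.1 (Submodule.inner_right_of_mem_orthogonal hx
      (mem_span_orthogonal_iff.2 ?_))
    rintro _ ⟨k, hk, rfl⟩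
    have hki : k < i := lt_of_lt_of_le hk hji
    exact hf.2 (i := ⟨k, hki.trans i.2⟩) (j := i) (fun h => by simp [← h] at hki)
  have hM : ∀ i j : Fin n, j ≤ i → LinearMap.toMatrix B B A i j = ⟪f i, l j • f j⟫_ℂ :=
    fun i j hji => by
      rw [LinearMap.toMatrix_apply, hrepr, hA, hB, ← sub_eq_zero, ← inner_sub_right]
      exact hort i j _ (hT j j.2) hji
  have hdet : LinearMap.det A = ∏ i : Fin n, l i := by
    rw [← LinearMap.det_toMatrix B A, Matrix.det_of_isUpperTriangular]
    · refine Finset.prod_congr rfl fun i _ => ?_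
      have := hf.1 i
      rw [hM i i le_rfl, inner_smul_right, inner_self_eq_norm_sq_to_K, this]
      simp
    · intro i j hij
      have hij' : j < i := hij
      rw [hM i j hij'.le, inner_smul_right, hf.2 (i := i) (j := j) hij'.ne', mul_zero]
  have hcard : Module.finrank ℂ E = Fintype.card (Fin n) := Module.finrank_eq_card_basis B
  -- Gram–Schmidt on the projected `u i` makes `g k` orthogonal to `u i` for all `i < k`, whence `‖A
  -- (g k)‖ ≤ s k`; Hadamard's inequality then finishes.
  let w : Fin n → E := fun i => E.orthogonalProjectionOnto (u i)
  let g := InnerProductSpace.gramSchmidtOrthonormalBasis hcard w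
  have hg : ∀ k : Fin n, ‖A (g k)‖ ≤ s k := fun k => by
    have h1 : ∀ i < (k : ℕ), ⟪u i, (g k : H)⟫_ℂ = 0 := fun i hi => by
      have h2 := InnerProductSpace.gramSchmidtOrthonormalBasis_inv_triangular hcard w
        (i := ⟨i, hi.trans k.2⟩) (j := k) hi
      rw [inner_eq_zero_symm] at h2
      rwa [Submodule.inner_orthogonalProjectionOnto_eq_of_mem_right] at h2
    have h3 := hs k (g k) h1
    rwa [← hA, Submodule.norm_coe, Submodule.norm_coe, g.norm_eq_one, mul_one] at h3
  rw [← Fin.prod_univ_eq_prod_range (fun i => ‖l i‖), ← Fin.prod_univ_eq_prod_range s, ← norm_prod,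
    ← hdet]
  exact (LinearMap.norm_det_le_prod_norm g A).trans
    (Finset.prod_le_prod (fun i _ => norm_nonneg _) fun i _ => hg i)

end Weyl

/-! ### The normal and quasi-nilpotent summands. -/

section Decomposition

variable {H : Type*} [NormedAddCommGroup H] [InnerProductSpace ℂ H] [CompleteSpace H]

theorem le_geomMeans_of_prod_le {s a : ℕ → ℝ} {n : ℕ} (ha : Antitone a) (ha0 : ∀ n, 0 ≤ a n)
    (h : ∏ i ∈ Finset.range (n + 1), a i ≤ ∏ i ∈ Finset.range (n + 1), s i) :
    a n ≤ geomMeans s n := by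
  have h1 : a n ^ (n + 1) ≤ ∏ i ∈ Finset.range (n + 1), a i := by
    calc a n ^ (n + 1) = ∏ _i ∈ Finset.range (n + 1), a n := by simp
      _ ≤ _ := Finset.prod_le_prod (fun _ _ => ha0 n)
        fun i hi => ha (Nat.lt_succ_iff.1 (Finset.mem_range.1 hi))
  have h2 : a n = (a n ^ (n + 1)) ^ ((1 : ℝ) / ((n : ℝ) + 1)) := by
    rw [← Real.rpow_natCast, ← Real.rpow_mul (ha0 n)]
    push_cast
    rw [mul_one_div_cancel (by positivity), Real.rpow_one]
  rw [geomMeans, h2]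
  exact Real.rpow_le_rpow (pow_nonneg (ha0 n) _) (h1.trans h) (by positivity)

/-- The diagonal operator of singular values of `T` lies in every ideal containing `T`. -/
theorem diagMem_singularValues {J : TwoSidedIdeal (H →L[ℂ] H)} (b : HilbertBasis ℕ ℂ H)
    {T : H →L[ℂ] H} (hT : T ∈ J) {u : ℕ → H} {s : ℕ → ℝ}
    (hu : ∀ {i j}, i ≠ j → ⟪u i, u j⟫_ℂ = 0) (hun : ∀ n, u n = 0 ∨ ‖u n‖ = 1)
    (hTu : ∀ {i j}, i ≠ j → ⟪T (u i), T (u j)⟫_ℂ = 0) (hs : ∀ n, ‖T (u n)‖ = s n) :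
    DiagMem J b s := by
  obtain ⟨U, hU, -, -⟩ := b.exists_clm_of_orthogonal hu hun
  -- Left singular vectors; `0⁻¹ = 0` makes `w n` vanish when `s n = 0`.
  let w : ℕ → H := fun n => ((s n : ℂ))⁻¹ • T (u n)
  have hw : ∀ n, w n = 0 ∨ ‖w n‖ = 1 := fun n => by
    by_cases h0 : s n = 0
    · exact Or.inl (by simp [w, h0])
    · refine Or.inr ?_
      have hpos : 0 ≤ s n := hs n ▸ norm_nonneg _
      rw [norm_smul, norm_inv, Complex.norm_real, hs, Real.norm_of_nonneg hpos, inv_mul_cancel₀ h0]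
  have hTw : ∀ n, T (u n) = (s n : ℂ) • w n := fun n => by
    by_cases h0 : s n = 0
    · rw [h0, Complex.ofReal_zero, zero_smul, ← norm_eq_zero, hs, h0]
    · simp [w, h0]
  obtain ⟨W, -, hW, -⟩ := b.exists_clm_of_orthogonal (v := w)
    (fun {i j} hij => by
      rw [inner_smul_left, inner_smul_right, hTu hij, mul_zero, mul_zero]) hw
  refine ⟨(W†) * T * U, J.mul_mem_right _ _ (J.mul_mem_left _ _ hT), fun n => ?_⟩
  rw [mul_apply_eq_comp, mul_apply_eq_comp, hU, hTw, map_smul]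
  by_cases h0 : w n = 0
  · have : s n = 0 := by rw [← hs, hTw, h0, smul_zero, norm_zero]
    simp [this]
  · rw [hW n h0]

theorem isQuasinilpotent_of_triangular [Nontrivial H] {T Q : H →L[ℂ] H} {f : ℕ → H} {l : ℕ → ℂ}
    (h : IsGreedyTriangularization T f l) (hT : IsCompactOperator T) (hQ : IsCompactOperator Q)
    (hQf : ∀ n, Q (f n) = T (f n) - l n • f n)
    (hQT : ∀ g, (∀ n, ⟪f n, g⟫_ℂ = 0) → (Q†) g = (T†) g) : IsQuasinilpotent Q := by
  refine (spectrum.nonempty Q).subset_singleton_iff.1 fun μ hμ => ?_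
  by_contra hμ0
  rw [Set.mem_singleton_iff] at hμ0
  have hQa : IsCompactOperator (Q†) := hQ.adjoint
  obtain ⟨g, hg0, hg⟩ := hQa.exists_eigenvector (star_ne_zero.2 hμ0)
    (star_mem_spectrum_adjoint.2 hμ)
  -- `Q (f n)` lies in the span of earlier `f i`, so induction gives `star μ * ⟪f n, g⟫ = 0`.
  have horth : ∀ n, ⟪f n, g⟫_ℂ = 0 := fun n => by
    induction n using Nat.strong_induction_on with
    | _ n ih =>
      have h1 : ⟪Q (f n), g⟫_ℂ = 0 := by
        rw [hQf]
        refine Submodule.inner_right_of_mem_orthogonal (h.sub_mem n)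
          (mem_span_orthogonal_iff.2 ?_)
        rintro _ ⟨i, hi, rfl⟩
        exact ih i hi
      rw [← ContinuousLinearMap.adjoint_inner_right, hg, inner_smul_right] at h1
      exact (mul_eq_zero.1 h1).resolve_left (star_ne_zero.2 hμ0)
  have hle : ∀ n, ‖μ‖ ≤ ‖l n‖ := fun n => by
    simpa using h.norm_le n _ g hg0 (fun i _ => horth i) ((hQT g horth).symm.trans hg)
  have := ge_of_tendsto' (h.tendsto_zero hT).norm hle
  rw [norm_zero] at this
  exact hμ0 (norm_le_zero_iff.1 this)

/-- The normal operator with eigenvectors `f n` and eigenvalues `l n`. -/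
theorem exists_normal_of_diagonal {J : TwoSidedIdeal (H →L[ℂ] H)} {b : HilbertBasis ℕ ℂ H}
    {L : H →L[ℂ] H} (hL : L ∈ J) {f : ℕ → H} {l : ℕ → ℂ} (hLb : ∀ n, L (b n) = l n • b n)
    (hf : ∀ {i j}, i ≠ j → ⟪f i, f j⟫_ℂ = 0) (hf1 : ∀ {n}, l n ≠ 0 → ‖f n‖ = 1)
    (hf0 : ∀ {n}, l n = 0 → f n = 0) :
    ∃ D ∈ J, IsStarNormal D ∧ (∀ n, D (f n) = l n • f n) ∧
      ∀ g, (∀ n, ⟪f n, g⟫_ℂ = 0) → (D†) g = 0 := by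
  have hne : ∀ {n}, l n ≠ 0 → f n ≠ 0 := fun {n} h h0 => by simpa [h0] using hf1 h
  obtain ⟨V, hV, hVa, hV0⟩ := b.exists_clm_of_orthogonal hf fun n =>
    if h : l n = 0 then Or.inl (hf0 h) else Or.inr (hf1 h)
  have hDa : (V * L * (V†))† = V * (L†) * (V†) := by
    simp only [← ContinuousLinearMap.star_eq_adjoint, star_mul, star_star, mul_assoc]
  have hLa := b.adjoint_diagonal hLb
  have hVV : ∀ n, l n ≠ 0 → (V†) (V (b n)) = b n := fun n h => by rw [hV, hVa n (hne h)]
  refine ⟨V * L * (V†), J.mul_mem_right _ _ (J.mul_mem_left _ _ hL), ⟨?_⟩, fun n => ?_,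
    fun g hg => ?_⟩
  · have hc : (L†) * ((V†) * V) * L = L * ((V†) * V) * (L†) := by
      refine b.ext_clm fun n => ?_
      by_cases h : l n = 0
      · simp [hLb, hLa, h]
      · simp [hLb, hLa, hVV n h, smul_smul, mul_comm]
    rw [commute_iff_eq, ContinuousLinearMap.star_eq_adjoint, hDa]
    calc V * (L†) * (V†) * (V * L * (V†)) = V * ((L†) * ((V†) * V) * L) * (V†) := by
          simp only [mul_assoc]
      _ = _ := by rw [hc]; simp only [mul_assoc]
  · by_cases h : l n = 0
    · simp [hf0 h]
    · simp [hVa n (hne h), hLb, hV]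
  · rw [hDa]
    simp [hV0 g hg]

end Decomposition

theorem corollary2p5 {H : Type*} [NormedAddCommGroup H] [InnerProductSpace ℂ H]
    [CompleteSpace H] [TopologicalSpace.SeparableSpace H] (hH : ¬ FiniteDimensional ℂ H)
    (J : TwoSidedIdeal (H →L[ℂ] H)) (hJc : ∀ A ∈ J, IsCompactOperator A)
    (hJ : IsGeometricallyStable J) (T : H →L[ℂ] H) (hT : T ∈ J) :
    ∃ D Q : H →L[ℂ] H, D ∈ J ∧ IsStarNormal D ∧ Q ∈ J ∧ IsQuasinilpotent Q ∧ T = D + Q := by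
  have : Nontrivial H := by
    by_contra h
    rw [not_nontrivial_iff_subsingleton] at h
    exact hH inferInstance
  obtain ⟨b, hb⟩ := hJ
  have hTc := hJc T hT
  obtain ⟨f, l, h⟩ := hTc.exists_greedyTriangularization
  obtain ⟨u, s, hsa, hs0, hu, hun, hTu, hTs, hs⟩ := hTc.exists_singularValues
  have hG : DiagMem J b (geomMeans s) :=
    (hb s hsa hs0).1 (diagMem_singularValues b hT hu hun hTu hTs)
  have hl : ∀ n, ‖l n‖ ≤ geomMeans s n := fun n => by
    refine le_geomMeans_of_prod_le h.antitone (fun n => norm_nonneg _) ?_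
    -- If `l n ≠ 0`, monotonicity makes all earlier entries nonzero, so `f 0, …, f n` are genuinely
    -- orthonormal and Weyl's inequality applies.
    by_cases h0 : l n = 0
    · rw [Finset.prod_eq_zero (Finset.self_mem_range_succ n) (by rw [h0, norm_zero])]
      exact Finset.prod_nonneg fun i _ => hs0 i
    have hne : ∀ i ≤ n, l i ≠ 0 := fun i hi hi0 => h0 (norm_le_zero_iff.1 (by
      simpa [hi0] using h.antitone hi))
    exact prod_norm_le_prod_of_triangular hs
      ⟨fun i => h.norm_eq_one (hne i (Nat.lt_succ_iff.1 i.2)),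
        fun i j hij => h.inner_eq_zero fun h => hij (Fin.ext h)⟩ fun k _ => h.sub_mem k
  obtain ⟨L, hL, hLb⟩ := hG.exists_of_norm_le hl
  obtain ⟨D, hD, hDn, hDf, hD0⟩ := exists_normal_of_diagonal hL hLb h.inner_eq_zero
    h.norm_eq_one h.eq_zero
  have hQ : T - D ∈ J := J.sub_mem hT hD
  refine ⟨D, T - D, hD, hDn, hQ, ?_, by abel⟩
  refine isQuasinilpotent_of_triangular h hTc (hJc _ hQ) (fun n => ?_) fun g hg => ?_
  · simp [hDf]
  · simp [hD0 g hg]
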